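/- Let $p>2$ be a prime. A left cancellative left semi-brace is a set $B$ with two operations such that $(B,+)$ is a left cancellative semigroup, $(B,\circ)$ is a group (with neutral element $0$, and $a^-$ denoting the inverse of $a$), and $a\circ(b+c)=a\circ b+a\circ(a^-+c)$ for all $a,b,c\in B$. Put $E=\{e\in B: e+e=e\}$ and $G=B+0=\{b+0: b\in B\}$, which is a subgroup of $(B,\circ)$. An isomorphism is a bijection preserving both operations. Let $G_3$ be $(\mathbb Z/p)^2$ with the usual addition and with $\circ$ equal to $+$, and let $G_4$ be $(\mathbb Z/p)^2$ with the usual addition and $(g_1,f_1)\circ(g_2,f_2)=(g_1+g_2+f_1f_2,\;f_1+f_2)$. For $A\in\{G_3,G_4\}$ and a homomorphism $\alpha:\mathbb Z/2\to\mathrm{Aut}(A,+,\circ)$, let $A\rtimes_\alpha\mathbb Z/2$ be the set $A\times\mathbb Z/2$ with $$(a_1,e_1)+(a_2,e_2)=(a_1+a_2,\,e_2),\qquad (a_1,e_1)\circ(a_2,e_2)=(a_1\circ\alpha_{e_1}(a_2),\,e_1+e_2).$$ Theorem. Consider the following five structures: 1) $G_3\times\mathbb Z/2$ (trivial $\alpha$);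 2) $G_3\rtimes_{\alpha_1}\mathbb Z/2$, where $\alpha_{1,e}(g,h)=((-1)^e g,(-1)^e h)$; 3) $G_3\rtimes_{\alpha_2}\mathbb Z/2$, where $\alpha_{2,e}(g,h)=(g,(-1)^e h)$; 4) $G_4\times\mathbb Z/2$ (trivial $\alpha$); 5) $G_4\rtimes_{\beta}\mathbb Z/2$, where $\beta_e(g,h)=(g,(-1)^e h)$, i.e. $(g_1,h_1,e_1)\circ(g_2,h_2,e_2)=(g_1+g_2+(-1)^{e_1}h_1h_2,\;h_1+(-1)^{e_1}h_2,\;e_1+e_2)$. Each of them is a left cancellative left semi-brace of size $2p^2$ with $E=\{0\}\times\mathbb Z/2$ (so $|E|=2$), $G=(\mathbb Z/p)^2\times\{0\}$ and $(G,\circ)\cong(\mathbb Z/p)^2$. They are pairwise non-isomorphic. Conversely, every left cancellative left semi-brace $B$ of size $2p^2$ with $|E|=2$ and $(G,\circ)\cong(\mathbb Z/p)^2$ is isomorphic to one of them. -/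

import Mathlib

/-- A left cancellative left semi-brace `(B, +, ∘)`. The group operation `∘` is written
multiplicatively, so its neutral element is `1` and the inverse of `a` is `a⁻¹`; the addition is
a left cancellative semigroup operation (it has no neutral element in general). -/
class LeftSemiBrace (B : Type*) extends Group B, AddLeftCancelSemigroup B where
  mul_add_eq : ∀ a b c : B, a * (b + c) = a * b + a * (a⁻¹ + c)

namespace LeftSemiBrace

theorem one_add_eq {B : Type*} [LeftSemiBrace B] (c : B) : 1 + c = c := by
  have h := mul_add_eq (1 : B) c c
  simp only [one_mul, inv_one] at h
  exact (add_left_cancel h).symm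

theorem mul_inv_add_one_eq_iff {B : Type*} [LeftSemiBrace B] (a : B) :
    a * (a⁻¹ + 1) = 1 ↔ a + 1 = a := by
  have h := mul_add_eq a 1 1
  rw [one_add_eq, mul_one] at h
  constructor
  · intro h1
    rw [h1] at h
    exact h.symm
  · intro h1
    exact add_left_cancel (h.symm.trans h1.symm)

theorem mem_range_add_one_iff {B : Type*} [LeftSemiBrace B] (a : B) :
    a ∈ Set.range (fun b : B => b + 1) ↔ a + 1 = a := by
  constructor
  · rintro ⟨b, rfl⟩
    simp only [add_assoc, one_add_eq]
  · intro h
    exact ⟨a, h⟩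

/-- The set `E` of idempotents of the semigroup `(B, +)`. -/
def idempotents (B : Type*) [LeftSemiBrace B] : Set B := {e | e + e = e}

/-- The subgroup `G = B + 1` of `(B, ∘)`, where `1` is the neutral element of `∘`. -/
def skewPart (B : Type*) [LeftSemiBrace B] : Subgroup B where
  carrier := Set.range (fun b : B => b + 1)
  one_mem' := ⟨1, one_add_eq 1⟩
  mul_mem' := by
    intro a b ha hb
    rw [mem_range_add_one_iff] at ha hb ⊢
    have h := mul_add_eq a b 1
    rw [(mul_inv_add_one_eq_iff a).2 ha, hb] at h
    exact h.symm
  inv_mem' := by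
    intro a ha
    rw [mem_range_add_one_iff] at ha ⊢
    exact (inv_eq_of_mul_eq_one_right ((mul_inv_add_one_eq_iff a).2 ha)).symm

/-- The trivial left semi-brace on a group `T`: the addition is `a + b = b`. -/
def Triv (T : Type*) : Type _ := T

instance {T : Type*} [Group T] : Group (Triv T) := inferInstanceAs (Group T)

instance {T : Type*} [Group T] : Add (Triv T) := ⟨fun _ b => b⟩

theorem Triv.add_def {T : Type*} [Group T] (a b : Triv T) : a + b = b := rfl

instance {T : Type*} [Group T] : LeftSemiBrace (Triv T) where
  add_assoc _ _ _ := rfl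
  add_left_cancel _ _ _ h := h
  mul_add_eq a b c := by simp only [Triv.add_def]

/-- The semidirect product `A ⋊_α C` of two left cancellative left semi-braces, where `α` is a
homomorphism from `(C, ∘)` to the group `RingAut A` of the permutations of `A` that preserve
both operations. -/
@[ext]
structure Semidirect {A C : Type*} [LeftSemiBrace A] [LeftSemiBrace C] (α : C →* RingAut A) where
  left : A
  right : C

namespace Semidirect

variable {A C : Type*} [LeftSemiBrace A] [LeftSemiBrace C] (α : C →* RingAut A)

instance : Mul (Semidirect α) := ⟨fun x y => ⟨x.left * α x.right y.left, x.right * y.right⟩⟩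

instance : One (Semidirect α) := ⟨⟨1, 1⟩⟩

instance : Inv (Semidirect α) := ⟨fun x => ⟨α x.right⁻¹ x.left⁻¹, x.right⁻¹⟩⟩

instance : Add (Semidirect α) := ⟨fun x y => ⟨x.left + y.left, x.right + y.right⟩⟩

@[simp] theorem mul_left (x y : Semidirect α) :
    (x * y).left = x.left * α x.right y.left := rfl

@[simp] theorem mul_right (x y : Semidirect α) : (x * y).right = x.right * y.right := rfl

@[simp] theorem one_left : (1 : Semidirect α).left = 1 := rfl

@[simp] theorem one_right : (1 : Semidirect α).right = 1 := rfl

@[simp] theorem inv_left (x : Semidirect α) : (x⁻¹).left = α x.right⁻¹ x.left⁻¹ := rfl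

@[simp] theorem inv_right (x : Semidirect α) : (x⁻¹).right = x.right⁻¹ := rfl

@[simp] theorem add_left (x y : Semidirect α) : (x + y).left = x.left + y.left := rfl

@[simp] theorem add_right (x y : Semidirect α) : (x + y).right = x.right + y.right := rfl

instance : Group (Semidirect α) :=
  Group.ofLeftAxioms
    (by intro x y z; ext <;> simp [mul_assoc])
    (by intro x; ext <;> simp)
    (by intro x; ext <;> simp)

instance : LeftSemiBrace (Semidirect α) where
  add_assoc x y z := by ext <;> simp [add_assoc]
  add_left_cancel x y z h := by
    have h1 := congrArg Semidirect.left h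
    have h2 := congrArg Semidirect.right h
    ext
    · exact _root_.add_left_cancel h1
    · exact _root_.add_left_cancel h2
  mul_add_eq x y z := by
    ext
    · have h : α x.right (α x.right⁻¹ x.left⁻¹) = x.left⁻¹ := by
        rw [← RingAut.mul_apply, ← map_mul, mul_inv_cancel, map_one, RingAut.one_apply]
      simp only [mul_left, add_left, map_add, inv_left]
      rw [mul_add_eq, h]
    · simp only [mul_right, add_right, inv_right]
      exact mul_add_eq _ _ _

end Semidirect

/-- The trivial brace on `ℤ/p × ℤ/p`: both operations are the usual addition of pairs. -/
@[ext]
structure G₃ (p : ℕ) where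
  fst : ZMod p
  snd : ZMod p

namespace G₃

variable (p : ℕ)

instance : Mul (G₃ p) := ⟨fun x y => ⟨x.fst + y.fst, x.snd + y.snd⟩⟩

instance : One (G₃ p) := ⟨⟨0, 0⟩⟩

instance : Inv (G₃ p) := ⟨fun x => ⟨-x.fst, -x.snd⟩⟩

instance : Add (G₃ p) := ⟨fun x y => ⟨x.fst + y.fst, x.snd + y.snd⟩⟩

@[simp] theorem mul_def (x y : G₃ p) : x * y = ⟨x.fst + y.fst, x.snd + y.snd⟩ := rfl

@[simp] theorem one_def : (1 : G₃ p) = ⟨0, 0⟩ := rfl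

@[simp] theorem inv_def (x : G₃ p) : x⁻¹ = ⟨-x.fst, -x.snd⟩ := rfl

@[simp] theorem add_def (x y : G₃ p) : x + y = ⟨x.fst + y.fst, x.snd + y.snd⟩ := rfl

instance : Group (G₃ p) :=
  Group.ofLeftAxioms
    (by intro x y z; ext <;> simp [add_assoc])
    (by intro x; ext <;> simp)
    (by intro x; ext <;> simp)

instance : LeftSemiBrace (G₃ p) where
  add_assoc x y z := by ext <;> simp [add_assoc]
  add_left_cancel x y z h := by simpa [G₃.ext_iff] using h
  mul_add_eq x y z := by ext <;> simp [add_assoc]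

/-- The automorphism `(g, h) ↦ (-g, -h)`. -/
def α₁ : RingAut (G₃ p) where
  toFun x := ⟨-x.fst, -x.snd⟩
  invFun x := ⟨-x.fst, -x.snd⟩
  left_inv x := by ext <;> simp
  right_inv x := by ext <;> simp
  map_mul' x y := by ext <;> simp [add_comm]
  map_add' x y := by ext <;> simp [add_comm]

/-- The automorphism `(g, h) ↦ (g, -h)`. -/
def α₂ : RingAut (G₃ p) where
  toFun x := ⟨x.fst, -x.snd⟩
  invFun x := ⟨x.fst, -x.snd⟩
  left_inv x := by ext <;> simp
  right_inv x := by ext <;> simp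
  map_mul' x y := by ext <;> simp [add_comm]
  map_add' x y := by ext <;> simp [add_comm]

theorem α₁_sq : α₁ p ^ 2 = 1 := by
  ext x <;> simp [sq, α₁]

theorem α₂_sq : α₂ p ^ 2 = 1 := by
  ext x <;> simp [sq, α₂]

end G₃

/-- The brace on `ℤ/p × ℤ/p` with the usual addition and
`(g₁, f₁) ∘ (g₂, f₂) = (g₁ + g₂ + f₁ f₂, f₁ + f₂)`. -/
@[ext]
structure G₄ (p : ℕ) where
  fst : ZMod p
  snd : ZMod p

namespace G₄

variable (p : ℕ)

instance : Mul (G₄ p) :=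
  ⟨fun x y => ⟨x.fst + y.fst + x.snd * y.snd, x.snd + y.snd⟩⟩

instance : One (G₄ p) := ⟨⟨0, 0⟩⟩

instance : Inv (G₄ p) := ⟨fun x => ⟨-x.fst + x.snd * x.snd, -x.snd⟩⟩

instance : Add (G₄ p) := ⟨fun x y => ⟨x.fst + y.fst, x.snd + y.snd⟩⟩

@[simp] theorem mul_def (x y : G₄ p) :
    x * y = ⟨x.fst + y.fst + x.snd * y.snd, x.snd + y.snd⟩ := rfl

@[simp] theorem one_def : (1 : G₄ p) = ⟨0, 0⟩ := rfl

@[simp] theorem inv_def (x : G₄ p) : x⁻¹ = ⟨-x.fst + x.snd * x.snd, -x.snd⟩ := rfl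

@[simp] theorem add_def (x y : G₄ p) : x + y = ⟨x.fst + y.fst, x.snd + y.snd⟩ := rfl

instance : Group (G₄ p) :=
  Group.ofLeftAxioms
    (by intro x y z; ext <;> simp <;> ring)
    (by intro x; ext <;> simp)
    (by intro x; ext <;> simp)

instance : LeftSemiBrace (G₄ p) where
  add_assoc x y z := by ext <;> simp [add_assoc]
  add_left_cancel x y z h := by simpa [G₄.ext_iff] using h
  mul_add_eq x y z := by ext <;> simp <;> ring

/-- The automorphism `(g, h) ↦ (g, -h)`. -/
def β : RingAut (G₄ p) where
  toFun x := ⟨x.fst, -x.snd⟩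
  invFun x := ⟨x.fst, -x.snd⟩
  left_inv x := by ext <;> simp
  right_inv x := by ext <;> simp
  map_mul' x y := by ext <;> simp [add_comm]
  map_add' x y := by ext <;> simp [add_comm]

theorem β_sq : β p ^ 2 = 1 := by
  ext x <;> simp [sq, β]

end G₄

/-- The trivial left semi-brace on the group `ℤ/2`. -/
abbrev E₂ : Type := Triv (Multiplicative (ZMod 2))

/-- The homomorphism `e ↦ a ^ e` from `ℤ/2` to a group, for an element `a` with `a ^ 2 = 1`. -/
def powHom {H : Type*} [Group H] (a : H) (ha : a ^ 2 = 1) : E₂ →* H :=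
  MonoidHom.mk' (M := E₂) (fun e => a ^ (Multiplicative.toAdd (α := ZMod 2) e).val) (by
    intro x y
    change a ^ (Multiplicative.toAdd (α := ZMod 2) x + Multiplicative.toAdd (α := ZMod 2) y).val = _
    rw [← pow_add, ZMod.val_add]
    conv_rhs => rw [← Nat.mod_add_div (_ + _) 2, pow_add, pow_mul, ha, one_pow, mul_one])

/-- A left cancellative left semi-brace together with an action of `ℤ/2` on it. -/
structure ActionDatum where
  A : Type
  [inst : LeftSemiBrace A]
  act : E₂ →* RingAut A

attribute [instance] ActionDatum.inst

/-- The five pairs (brace of size `p²`, action of `ℤ/2`): the brace `G₃` with the trivial action,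
with `α₁` and with `α₂`; the brace `G₄` with the trivial action and with `β`. -/
def datum (p : ℕ) : Fin 5 → ActionDatum
  | 0 => ⟨G₃ p, 1⟩
  | 1 => ⟨G₃ p, powHom (G₃.α₁ p) (G₃.α₁_sq p)⟩
  | 2 => ⟨G₃ p, powHom (G₃.α₂ p) (G₃.α₂_sq p)⟩
  | 3 => ⟨G₄ p, 1⟩
  | 4 => ⟨G₄ p, powHom (G₄.β p) (G₄.β_sq p)⟩

/-- The five left cancellative left semi-braces `A ⋊ ℤ/2` given by `datum`. -/
abbrev Model (p : ℕ) (i : Fin 5) : Type := Semidirect (datum p i).act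

end LeftSemiBrace

/-!
Write `1` for the common neutral element `0` of the informal notation, `λ_a(b) = a ∘ (a⁻ + b)`,
`G = B + 1`, and `E` for the idempotents. Then `a ∘ b = a + λ_a(b)`, each `λ_a` is additive, every
idempotent is a left identity for `+`, and every element of `B` is uniquely `g + e` with `g ∈ G`
and `e ∈ E`.

Let `E = {1, t}`. For `g ∈ G` the map `λ_g` permutes `E` and fixes `1`, hence fixes `t`, so that
`g ∘ t = g + t`. The subgroup `G` has index `2`, hence is normal, and conjugation by `t` preserves
both operations of `G` (`conjSkewPart`). Therefore `B` is the semidirect product of `G` with `ℤ/2`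
acting through this conjugation (`nonempty_equiv_semidirect`), and it remains to classify the braces
`G` and their automorphisms `τ` with `τ² = 1` up to conjugacy.

Groups of order `p²` are abelian, so `G` is a commutative brace, that is, `a ∘ b = a + b + a b` for
a commutative ring product `a b = λ_a(b) - b`. Multiplication by `y` is `D = λ_y - 1` with
`λ_y ^ p = 1`, so `D ^ p` is divisible by `p` in the endomorphism ring and `D` is nilpotent; on a
group of order `p²` this forces `D² = 0` and `p D = 0`. If all squares `y²` vanish, the product is
zero (`p` is odd) and `G ≅ G₃`. Otherwise take `u = y² ≠ 0`; the binomial formula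
`y^{∘ p} = p y + (p choose 2) u` gives `p y = 0`, and `u`, `y` is a basis in which `G` is `G₄`
(`nonempty_equiv_G₃_or_G₄`).

The involutions are found in coordinates (`G₃.conj_of_sq_eq_one`, `G₄.conj_of_sq_eq_one`). The five
models are separated by three properties (`eq_of_model_equiv`): whether the operations agree on `G`,
whether `∘` is commutative, and whether `G` contains a nontrivial central element of `(B, ∘)`.
-/

/-! ### Nilpotent endomorphisms of groups of order `p²` -/

/-- The ranges of the powers of a nilpotent endomorphism decrease strictly until they vanish. -/
theorem AddMonoid.End.range_pow_succ_lt {S : Type*} [AddCommGroup S] [Finite S]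
    {D : AddMonoid.End S} (hD : IsNilpotent D) {k : ℕ} (hk : D ^ k ≠ 0) :
    AddMonoidHom.range (D ^ (k + 1)) < AddMonoidHom.range (D ^ k) := by
  have hle : AddMonoidHom.range (D ^ (k + 1)) ≤ AddMonoidHom.range (D ^ k) := by
    rintro _ ⟨x, rfl⟩
    exact ⟨D x, by rw [pow_succ]; rfl⟩
  refine lt_of_le_of_ne hle fun heq => hk ?_
  have hstab : ∀ n, ∀ x, ∃ z, (D ^ k) x = (D ^ (n + k)) z := by
    intro n
    induction n with
    | zero => exact fun x => ⟨x, by rw [zero_add]⟩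
    | succ n ih =>
      intro x
      have hx : (D ^ k) x ∈ AddMonoidHom.range (D ^ (k + 1)) := heq ▸ ⟨x, rfl⟩
      obtain ⟨w, hw⟩ := hx
      obtain ⟨z, hz⟩ := ih w
      refine ⟨z, ?_⟩
      rw [← hw, pow_succ', add_right_comm, pow_succ']
      exact congrArg D hz
  obtain ⟨n, hn⟩ := hD
  ext x
  obtain ⟨z, hz⟩ := hstab n x
  rw [hz, pow_add, hn, zero_mul]
  rfl

theorem AddSubgroup.card_lt_of_lt {S : Type*} [AddCommGroup S] [Finite S]
    {H K : AddSubgroup S} (h : H < K) : Nat.card H < Nat.card K :=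
  Set.ncard_lt_ncard (SetLike.coe_ssubset_coe.2 h) (Set.toFinite _)

theorem AddMonoid.End.card_range_dvd_prime {S : Type*} [AddCommGroup S] {p : ℕ} (hp : p.Prime)
    (hS : Nat.card S = p ^ 2) {D : AddMonoid.End S} (hD : IsNilpotent D) :
    Nat.card (AddMonoidHom.range D) ∣ p := by
  have : Finite S := Nat.finite_of_card_ne_zero (by rw [hS]; exact pow_ne_zero _ hp.ne_zero)
  have : Nontrivial S := by
    rw [← Finite.one_lt_card_iff_nontrivial, hS]
    exact Nat.one_lt_pow two_ne_zero hp.one_lt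
  obtain ⟨x, hx⟩ := exists_ne (0 : S)
  have hlt := AddSubgroup.card_lt_of_lt
    (range_pow_succ_lt hD (k := 0) fun h => hx (DFunLike.congr_fun h x))
  rw [zero_add, pow_one] at hlt
  obtain ⟨i, hi, hc⟩ := (Nat.dvd_prime_pow hp).1
    (hS ▸ AddSubgroup.card_addSubgroup_dvd_card (AddMonoidHom.range D))
  have hi2 : i ≠ 2 := by
    rintro rfl
    refine absurd (lt_of_lt_of_le hlt (Nat.card_le_card_of_injective _
      Subtype.val_injective)) ?_
    rw [hc, hS]
    exact lt_irrefl _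
  rw [hc]
  exact (pow_dvd_pow p (show i ≤ 1 by omega)).trans (by rw [pow_one])

theorem AddMonoid.End.mul_self_eq_zero_of_isNilpotent {S : Type*} [AddCommGroup S] {p : ℕ}
    (hp : p.Prime) (hS : Nat.card S = p ^ 2) {D : AddMonoid.End S} (hD : IsNilpotent D) :
    D * D = 0 := by
  have : Finite S := Nat.finite_of_card_ne_zero (by rw [hS]; exact pow_ne_zero _ hp.ne_zero)
  by_cases h0 : D = 0
  · rw [h0, zero_mul]
  have hlt := range_pow_succ_lt hD (k := 1) (by simpa using h0)
  have hdvd := (AddSubgroup.card_dvd_of_le hlt.le)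
  have hlt := AddSubgroup.card_lt_of_lt hlt
  rw [pow_one] at hlt hdvd
  have h1 : Nat.card (AddMonoidHom.range (D ^ (1 + 1))) = 1 := by
    rcases (Nat.dvd_prime hp).1 (hdvd.trans (card_range_dvd_prime hp hS hD)) with h | h
    · exact h
    · rw [h] at hlt
      exact absurd (Nat.le_of_dvd hp.pos (card_range_dvd_prime hp hS hD)) (not_le.2 hlt)
  rw [AddSubgroup.card_eq_one] at h1
  rw [← sq]
  ext x
  exact (AddSubgroup.mem_bot).1 (h1 ▸ ⟨x, rfl⟩ : (D ^ 2) x ∈ (⊥ : AddSubgroup S))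

/-- An automorphism of order dividing `p` of a group of exponent dividing `p²` is unipotent: modulo
`p`, the binomial formula reads `(1 + D) ^ p = 1 + D ^ p`. -/
theorem AddMonoid.End.isNilpotent_of_one_add_pow_eq_one {S : Type*} [AddCommGroup S] {p : ℕ}
    (hp : p.Prime) (hS : Nat.card S = p ^ 2) {D : AddMonoid.End S} (hD : (1 + D) ^ p = 1) :
    IsNilpotent D := by
  obtain ⟨r, hr⟩ := (Commute.one_left D).exists_add_pow_prime_eq hp
  rw [hD, one_pow, mul_one] at hr
  have hp2 : ((p : AddMonoid.End S)) * p = 0 := by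
    rw [← Nat.cast_mul, ← sq, ← hS]
    ext x
    simp
  have h1 : D ^ p = p * (-(D * r)) := by
    rw [add_assoc] at hr
    have := left_eq_add.1 hr
    rw [mul_neg, ← mul_assoc]
    exact eq_neg_of_add_eq_zero_left this
  refine ⟨p + p, ?_⟩
  rw [pow_add, h1, ← mul_assoc, mul_assoc (p : AddMonoid.End S), ← (Nat.cast_commute p _).eq,
    ← mul_assoc, hp2, zero_mul, zero_mul]

namespace LeftSemiBrace

/-! ### Elementary abelian groups of order `p²` -/

theorem card_of_mulEquiv {p : ℕ} {H : Type*} [Group H]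
    (e : H ≃* Multiplicative (ZMod p × ZMod p)) : Nat.card H = p ^ 2 := by
  rw [Nat.card_congr e.toEquiv]
  change Nat.card (ZMod p × ZMod p) = _
  rw [Nat.card_prod, Nat.card_zmod, sq]

theorem pow_prime_eq_one {p : ℕ} {H : Type*} [Group H]
    (e : H ≃* Multiplicative (ZMod p × ZMod p)) (x : H) : x ^ p = 1 := by
  apply e.injective
  rw [map_pow, map_one]
  change p • (Multiplicative.toAdd (e x)) = 0
  ext <;> simp

/-! ### Braces with elementary abelian multiplicative group of order `p²` -/

section Brace

variable {S : Type*} [AddCommGroup S] [CommGroup S]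

theorem one_eq_zero_of_brace (hd : ∀ a b c : S, a * (b + c) = a * b - a + a * c) :
    (1 : S) = 0 := by
  have h := hd 1 0 0
  rw [add_zero, one_mul, zero_sub, add_zero] at h
  exact (neg_eq_zero.1 h.symm)

/-- The action `λ` of the multiplicative group of a brace on its additive group,
`λ_a(b) = a ∘ b - a`. -/
def lambdaHom (hd : ∀ a b c : S, a * (b + c) = a * b - a + a * c) : S →* AddMonoid.End S where
  toFun a :=
    { toFun := fun b => a * b - a
      map_zero' := by
        have h := mul_one a
        rw [one_eq_zero_of_brace hd] at h
        rw [h, sub_self]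
      map_add' := fun b c => by rw [hd]; abel }
  map_one' := by
    ext b
    change 1 * b - 1 = b
    rw [one_mul, one_eq_zero_of_brace hd, sub_zero]
  map_mul' a b := by
    ext c
    change a * b * c - a * b = a * (b * c - b) - a
    have h := hd a (b * c - b) b
    rw [sub_add_cancel, ← mul_assoc] at h
    rw [h]
    abel

/-- The ring multiplication `b ↦ λ_a(b) - b` by an element `a` of a brace. -/
def starEnd (hd : ∀ a b c : S, a * (b + c) = a * b - a + a * c) (a : S) : AddMonoid.End S :=
  lambdaHom hd a - 1

variable (hd : ∀ a b c : S, a * (b + c) = a * b - a + a * c)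

theorem starEnd_apply (a b : S) : starEnd hd a b = a * b - a - b := rfl

theorem mul_eq_starEnd (a b : S) : a * b = a + b + starEnd hd a b := by
  rw [starEnd_apply]
  abel

theorem starEnd_comm (a b : S) : starEnd hd a b = starEnd hd b a := by
  rw [starEnd_apply, starEnd_apply, mul_comm]
  abel

theorem starEnd_add (a b : S) : starEnd hd (a + b) = starEnd hd a + starEnd hd b := by
  ext c
  rw [starEnd_comm, map_add, starEnd_comm, starEnd_comm hd c b]
  rfl

theorem starEnd_add_apply (a b c : S) :
    starEnd hd (a + b) c = starEnd hd a c + starEnd hd b c := by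
  rw [starEnd_add]
  rfl

/-- Associativity of the ring multiplication, from the multiplicativity of `λ`. -/
theorem starEnd_starEnd (a b : S) : starEnd hd (starEnd hd a b) = starEnd hd a * starEnd hd b := by
  have h : starEnd hd (a * b) =
      starEnd hd a + starEnd hd b + starEnd hd (starEnd hd a b) := by
    conv_lhs => rw [mul_eq_starEnd hd a b]
    rw [starEnd_add, starEnd_add]
  have h2 : starEnd hd (a * b) = (1 + starEnd hd a) * (1 + starEnd hd b) - 1 := by
    simp only [starEnd, add_sub_cancel, map_mul]
  rw [h2] at h
  have h3 := eq_sub_of_add_eq' h.symm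
  rw [h3]
  noncomm_ring

theorem isNilpotent_starEnd {p : ℕ} (hp : p.Prime) (hS : Nat.card S = p ^ 2)
    (hpow : ∀ x : S, x ^ p = 1) (a : S) : IsNilpotent (starEnd hd a) := by
  refine AddMonoid.End.isNilpotent_of_one_add_pow_eq_one hp hS ?_
  rw [starEnd, add_sub_cancel, ← map_pow, hpow, map_one]

/-- The binomial formula for powers with respect to `∘`, for an element with `y³ = 0` in the
attached ring. -/
theorem pow_eq_nsmul_add_choose_nsmul {y : S} (h : starEnd hd y * starEnd hd y = 0) (n : ℕ) :
    y ^ n = n • y + n.choose 2 • starEnd hd y y := by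
  induction n with
  | zero => simp [one_eq_zero_of_brace hd]
  | succ n ih =>
    have h0 : starEnd hd y (starEnd hd y y) = 0 := DFunLike.congr_fun h y
    rw [pow_succ', mul_eq_starEnd hd, ih, map_add, map_nsmul, map_nsmul, h0, smul_zero, add_zero,
      Nat.choose_succ_succ' n 1, Nat.choose_one_right, add_smul, add_smul, one_smul]
    abel

/-- The additive group has exponent `p`: `1 = y ^ p = p y + (p choose 2) y²`, and `p` kills the
ring product as well as dividing the binomial coefficient. Oddness of `p` is essential here. -/
theorem nsmul_prime_eq_zero {p : ℕ} (hp : p.Prime) (hp2 : 2 < p)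
    (hS : Nat.card S = p ^ 2) (hpow : ∀ x : S, x ^ p = 1) (a y : S) :
    p • starEnd hd a y = 0 ∧ p • y = 0 := by
  have hr : ∀ a y, p • starEnd hd a y = 0 := by
    intro a y
    have h := AddMonoid.End.card_range_dvd_prime hp hS (isNilpotent_starEnd hd hp hS hpow a)
    have h1 : addOrderOf (⟨starEnd hd a y, y, rfl⟩ : AddMonoidHom.range (starEnd hd a)) ∣ p :=
      (addOrderOf_dvd_natCard _).trans h
    have h2 := addOrderOf_dvd_iff_nsmul_eq_zero.1 h1
    exact congrArg Subtype.val h2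
  refine ⟨hr a y, ?_⟩
  have h := pow_eq_nsmul_add_choose_nsmul hd (AddMonoid.End.mul_self_eq_zero_of_isNilpotent hp hS
    (isNilpotent_starEnd hd hp hS hpow y)) p
  obtain ⟨k, hk⟩ := hp.dvd_choose_self two_ne_zero hp2
  rw [hpow, hk, mul_comm, mul_smul, hr, smul_zero, add_zero, one_eq_zero_of_brace hd] at h
  exact h.symm

theorem nonempty_equiv_G₃ {p : ℕ} (hp : p.Prime) (hp2 : 2 < p) (hS : Nat.card S = p ^ 2)
    (e : S ≃* Multiplicative (ZMod p × ZMod p)) (h : ∀ y, starEnd hd y y = 0) :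
    Nonempty (S ≃+* G₃ p) := by
  have hpow := pow_prime_eq_one e
  -- A commutative product with vanishing squares vanishes, by polarization.
  have h2 : ∀ a b, starEnd hd a b = 0 := by
    intro a b
    have h1 := h (a + b)
    rw [starEnd_add_apply, map_add, map_add, h, h, starEnd_comm hd b a, zero_add,
      add_zero, ← two_nsmul] at h1
    have h3 := (nsmul_prime_eq_zero hd hp hp2 hS hpow a b).1
    have hc : Nat.Coprime 2 p := (Nat.coprime_primes Nat.prime_two hp).2 hp2.ne
    have h4 := Nat.dvd_gcd (addOrderOf_dvd_iff_nsmul_eq_zero.2 h1)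
      (addOrderOf_dvd_iff_nsmul_eq_zero.2 h3)
    rw [hc] at h4
    simpa using addOrderOf_dvd_iff_nsmul_eq_zero.1 h4
  have hm : ∀ x y, (⟨(e (x * y)).toAdd.1, (e (x * y)).toAdd.2⟩ : G₃ p) =
      ⟨(e x).toAdd.1, (e x).toAdd.2⟩ * ⟨(e y).toAdd.1, (e y).toAdd.2⟩ := by
    intro x y
    rw [map_mul]
    rfl
  exact ⟨{
    toFun x := ⟨(e x).toAdd.1, (e x).toAdd.2⟩
    invFun x := e.symm (Multiplicative.ofAdd (x.fst, x.snd))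
    left_inv x := e.symm_apply_apply x
    right_inv x := by
      simp only [MulEquiv.apply_symm_apply]
      rfl
    map_mul' := hm
    map_add' x y := by
      have h := mul_eq_starEnd hd x y
      rw [h2, add_zero] at h
      rw [← h]
      exact hm x y }⟩

/-- If some square `u = y²` is nonzero, then `(i, j) ↦ i u + j y` identifies `G₄` with the brace. -/
theorem nonempty_equiv_G₄ {p : ℕ} (hp : p.Prime) (hp2 : 2 < p) (hS : Nat.card S = p ^ 2)
    (hpow : ∀ x : S, x ^ p = 1) {y : S} (hy : starEnd hd y y ≠ 0) :
    Nonempty (S ≃+* G₄ p) := by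
  have : Fact p.Prime := ⟨hp⟩
  have : Finite S := Nat.finite_of_card_ne_zero (by rw [hS]; exact pow_ne_zero _ hp.ne_zero)
  let _ : Module (ZMod p) S :=
    AddCommGroup.zmodModule fun x => (nsmul_prime_eq_zero hd hp hp2 hS hpow x x).2
  have hsmul : ∀ {c : ZMod p} {x : S}, c • x = 0 → x ≠ 0 → c = 0 := by
    intro c x h hx
    by_contra hc
    apply hx
    rw [← one_smul (ZMod p) x, ← inv_mul_cancel₀ hc, mul_smul, h, smul_zero]
  obtain ⟨u, hu⟩ : ∃ u, u = starEnd hd y y := ⟨_, rfl⟩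
  rw [← hu] at hy
  have hyy := AddMonoid.End.mul_self_eq_zero_of_isNilpotent hp hS
    (isNilpotent_starEnd hd hp hS hpow y)
  have hyu : starEnd hd y u = 0 := hu ▸ DFunLike.congr_fun hyy y
  have hu0 : starEnd hd u = 0 := by rw [hu, starEnd_starEnd, hyy]
  have hsr : ∀ (i : ZMod p) a b, starEnd hd a (i • b) = i • starEnd hd a b :=
    fun i a b => ZMod.map_smul (starEnd hd a) i b
  have hsl : ∀ (i : ZMod p) a b, starEnd hd (i • a) b = i • starEnd hd a b :=
    fun i a b => by rw [starEnd_comm, hsr, starEnd_comm]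
  have hstar : ∀ i j k l : ZMod p,
      starEnd hd (i • u + j • y) (k • u + l • y) = (j * l) • u := by
    intro i j k l
    have hu1 : ∀ x, starEnd hd u x = 0 := fun x => by rw [hu0]; rfl
    rw [starEnd_add_apply, hsl, hsl, hu1, smul_zero, zero_add, map_add, hsr, hsr,
      hyu, ← hu, smul_zero, zero_add, mul_smul]
  let f : G₄ p → S := fun x => x.fst • u + x.snd • y
  have hadd : ∀ a b, f (a + b) = f a + f b := by
    intro a b
    simp only [f, G₄.add_def, add_smul]
    abel
  have hmul : ∀ a b, f (a * b) = f a * f b := by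
    intro a b
    rw [mul_eq_starEnd hd (f a)]
    simp only [f, hstar, G₄.mul_def, add_smul]
    abel
  have hinj : Function.Injective f := by
    intro a b hab
    have h0 : (a.fst - b.fst) • u + (a.snd - b.snd) • y = 0 := by
      rw [sub_smul, sub_smul, ← sub_eq_zero.2 hab]
      simp only [f]
      abel
    -- Multiplying a linear relation by `y` kills `u`, so the coefficient of `y` vanishes.
    have h1 : (a.snd - b.snd) • u = 0 := by
      have h := congrArg (starEnd hd y) h0
      rwa [map_add, hsr, hsr, hyu, ← hu, smul_zero, zero_add, map_zero] at h
    have h2 := hsmul h1 hy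
    rw [h2, zero_smul, add_zero] at h0
    have h3 := hsmul h0 hy
    exact G₄.ext (sub_eq_zero.1 h3) (sub_eq_zero.1 h2)
  have hcard : Nat.card (G₄ p) = Nat.card S := by
    rw [hS, sq, Nat.card_congr (⟨fun x => (x.fst, x.snd), fun x => ⟨x.1, x.2⟩, fun _ => rfl,
      fun _ => rfl⟩ : G₄ p ≃ ZMod p × ZMod p), Nat.card_prod, Nat.card_zmod]
  have hbij : Function.Bijective f := by
    have : Finite (G₄ p) := Finite.of_injective f hinj
    exact (Nat.bijective_iff_injective_and_card f).2 ⟨hinj, hcard⟩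
  exact ⟨({ Equiv.ofBijective f hbij with
    map_mul' := hmul
    map_add' := hadd } : G₄ p ≃+* S).symm⟩

theorem nonempty_equiv_G₃_or_G₄ (hd : ∀ a b c : S, a * (b + c) = a * b - a + a * c) {p : ℕ} (hp : p.Prime) (hp2 : 2 < p)
    (e : S ≃* Multiplicative (ZMod p × ZMod p)) :
    Nonempty (S ≃+* G₃ p) ∨ Nonempty (S ≃+* G₄ p) := by
  have hS : Nat.card S = p ^ 2 := card_of_mulEquiv e
  have hpow := pow_prime_eq_one e
  by_cases h : ∀ y, starEnd hd y y = 0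
  · exact Or.inl (nonempty_equiv_G₃ hd hp hp2 hS e h)
  · push Not at h
    obtain ⟨y, hy⟩ := h
    exact Or.inr (nonempty_equiv_G₄ hd hp hp2 hS hpow hy)

end Brace

/-! ### Involutive automorphisms of the two braces of order `p²` -/

theorem exists_coeff_of_add_add {p : ℕ} {f : ZMod p → ZMod p → ZMod p}
    (hf : ∀ x y z w, f (x + z) (y + w) = f x y + f z w) :
    ∃ a b, ∀ x y, f x y = a * x + b * y := by
  let F : ZMod p × ZMod p →+ ZMod p := AddMonoidHom.mk' (fun v => f v.1 v.2) fun v w => hf _ _ _ _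
  refine ⟨f 1 0, f 0 1, fun x y => ?_⟩
  have h1 := ZMod.map_smul F x (1, 0)
  have h2 := ZMod.map_smul F y (0, 1)
  have h3 := F.map_add (x • (1, 0)) (y • (0, 1))
  rw [h1, h2] at h3
  simpa [F, mul_comm] using h3

theorem two_ne_zero_zmod {p : ℕ} (hp2 : 2 < p) : (2 : ZMod p) ≠ 0 := by
  intro h
  have h1 : ((2 : ℕ) : ZMod p) = 0 := by exact_mod_cast h
  exact absurd (Nat.le_of_dvd two_pos ((ZMod.natCast_eq_zero_iff 2 p).1 h1)) (not_le.2 hp2)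

theorem G₃.exists_coeff {p : ℕ} (τ : RingAut (G₃ p)) :
    ∃ a b c d : ZMod p, ∀ x y : ZMod p, τ ⟨x, y⟩ = ⟨a * x + b * y, c * x + d * y⟩ := by
  have h : ∀ x y z w : ZMod p, τ ⟨x + z, y + w⟩ = τ ⟨x, y⟩ + τ ⟨z, w⟩ :=
    fun x y z w => map_add τ ⟨x, y⟩ ⟨z, w⟩
  obtain ⟨a, b, h1⟩ := exists_coeff_of_add_add (f := fun x y => (τ ⟨x, y⟩).fst)
    fun x y z w => congrArg G₃.fst (h x y z w)
  obtain ⟨c, d, h2⟩ := exists_coeff_of_add_add (f := fun x y => (τ ⟨x, y⟩).snd)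
    fun x y z w => congrArg G₃.snd (h x y z w)
  exact ⟨a, b, c, d, fun x y => G₃.ext (h1 x y) (h2 x y)⟩

theorem G₄.exists_coeff {p : ℕ} (τ : RingAut (G₄ p)) :
    ∃ a b c d : ZMod p, ∀ x y : ZMod p, τ ⟨x, y⟩ = ⟨a * x + b * y, c * x + d * y⟩ := by
  have h : ∀ x y z w : ZMod p, τ ⟨x + z, y + w⟩ = τ ⟨x, y⟩ + τ ⟨z, w⟩ :=
    fun x y z w => map_add τ ⟨x, y⟩ ⟨z, w⟩
  obtain ⟨a, b, h1⟩ := exists_coeff_of_add_add (f := fun x y => (τ ⟨x, y⟩).fst)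
    fun x y z w => congrArg G₄.fst (h x y z w)
  obtain ⟨c, d, h2⟩ := exists_coeff_of_add_add (f := fun x y => (τ ⟨x, y⟩).snd)
    fun x y z w => congrArg G₄.snd (h x y z w)
  exact ⟨a, b, c, d, fun x y => G₄.ext (h1 x y) (h2 x y)⟩

/-- The automorphism of `(ℤ/p)²` with matrix columns `(a, c)` and `(b, d)`. -/
def G₃.ofMatrix {p : ℕ} [Fact p.Prime] (a b c d : ZMod p) (h : a * d - b * c ≠ 0) :
    RingAut (G₃ p) where
  toFun x := ⟨a * x.fst + b * x.snd, c * x.fst + d * x.snd⟩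
  invFun x := ⟨(a * d - b * c)⁻¹ * (d * x.fst - b * x.snd),
    (a * d - b * c)⁻¹ * (a * x.snd - c * x.fst)⟩
  left_inv x := by
    ext
    · change (a * d - b * c)⁻¹ * _ = _
      rw [inv_mul_eq_iff_eq_mul₀ h]
      ring
    · change (a * d - b * c)⁻¹ * _ = _
      rw [inv_mul_eq_iff_eq_mul₀ h]
      ring
  right_inv x := by
    ext
    · change a * ((a * d - b * c)⁻¹ * _) + b * ((a * d - b * c)⁻¹ * _) = _
      rw [mul_left_comm, mul_left_comm b, ← mul_add, inv_mul_eq_iff_eq_mul₀ h]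
      ring
    · change c * ((a * d - b * c)⁻¹ * _) + d * ((a * d - b * c)⁻¹ * _) = _
      rw [mul_left_comm, mul_left_comm d, ← mul_add, inv_mul_eq_iff_eq_mul₀ h]
      ring
  map_mul' x y := by ext <;> simp <;> ring
  map_add' x y := by ext <;> simp <;> ring

/-- An involution of `G₃` is `1`, or `-1`, or has an eigenvector for each of `1` and `-1`; these
form a basis in which it becomes `α₂`. -/
theorem G₃.conj_of_sq_eq_one {p : ℕ} (hp : p.Prime) (hp2 : 2 < p) {τ : RingAut (G₃ p)}
    (hτ : τ ^ 2 = 1) :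
    ∃ σ ρ : RingAut (G₃ p), (ρ = 1 ∨ ρ = G₃.α₁ p ∨ ρ = G₃.α₂ p) ∧ τ * σ = σ * ρ := by
  have : Fact p.Prime := ⟨hp⟩
  have h2 := two_ne_zero_zmod hp2
  have hτ2 : ∀ x, τ (τ x) = x := fun x => by
    rw [← RingAut.mul_apply, ← sq, hτ, RingAut.one_apply]
  by_cases h1 : ∀ x, τ x = x
  · exact ⟨1, 1, Or.inl rfl, by ext x <;> simp [h1]⟩
  by_cases h3 : ∀ x, τ x = G₃.α₁ p x
  · exact ⟨1, G₃.α₁ p, Or.inr (Or.inl rfl), by ext x <;> simp [h3]⟩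
  push Not at h1 h3
  obtain ⟨x, hx⟩ := h1
  obtain ⟨y, hy⟩ := h3
  obtain ⟨a, b, c, d, hm⟩ := G₃.exists_coeff τ
  -- The eigenvectors `w = y + τ y` for `1` and `v = x - τ x` for `-1`.
  obtain ⟨w, hw, hw0⟩ : ∃ w : G₃ p, τ w = w ∧ ¬ (w.fst = 0 ∧ w.snd = 0) := by
    refine ⟨y + τ y, by rw [map_add, hτ2]; ext <;> simp [add_comm], fun h => hy ?_⟩
    simp only [G₃.add_def] at h
    exact G₃.ext (eq_neg_of_add_eq_zero_right h.1) (eq_neg_of_add_eq_zero_right h.2)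
  obtain ⟨v, hv, hv0⟩ : ∃ v : G₃ p, τ v = G₃.α₁ p v ∧ ¬ (v.fst = 0 ∧ v.snd = 0) := by
    refine ⟨x + (τ x)⁻¹, ?_, fun h => hx ?_⟩
    · rw [map_add, map_inv, hτ2]
      ext <;> simp [G₃.α₁, add_comm]
    · simp only [G₃.add_def, G₃.inv_def] at h
      exact (G₃.ext (add_neg_eq_zero.1 h.1) (add_neg_eq_zero.1 h.2)).symm
  have hw' := hm w.fst w.snd
  have hv' := hm v.fst v.snd
  rw [hw] at hw'
  rw [hv] at hv'
  have e1 := congrArg G₃.fst hw'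
  have e2 := congrArg G₃.snd hw'
  have e3 : -v.fst = _ := congrArg G₃.fst hv'
  have e4 : -v.snd = _ := congrArg G₃.snd hv'
  simp only at e1 e2 e3 e4
  have hdet : w.fst * v.snd - v.fst * w.snd ≠ 0 := by
    intro h
    -- A relation between `w` and `v` would make `w` an eigenvector for both eigenvalues.
    have k1 : 2 * (w.fst * v.fst) = 0 := by
      linear_combination v.fst * e1 - w.fst * e3 - b * h
    have k2 : 2 * (w.snd * v.snd) = 0 := by
      linear_combination v.snd * e2 - w.snd * e4 + c * h
    have k1 := (mul_eq_zero.1 k1).resolve_left h2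
    have k2 := (mul_eq_zero.1 k2).resolve_left h2
    have k3 : (w.fst * v.snd) ^ 2 = 0 := by
      linear_combination w.fst * v.snd * h + w.snd * v.snd * k1
    have k4 : (v.fst * w.snd) ^ 2 = 0 := by
      linear_combination -v.fst * w.snd * h + w.snd * v.snd * k1
    simp only [sq_eq_zero_iff, mul_eq_zero] at k1 k2 k3 k4
    tauto
  refine ⟨G₃.ofMatrix w.fst v.fst w.snd v.snd hdet, G₃.α₂ p, Or.inr (Or.inr rfl), ?_⟩
  ext z
  · change (τ ⟨_, _⟩).fst = w.fst * z.fst + v.fst * (-z.snd)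
    rw [hm]
    linear_combination -z.fst * e1 - z.snd * e3
  · change (τ ⟨_, _⟩).snd = w.snd * z.fst + v.snd * (-z.snd)
    rw [hm]
    linear_combination -z.fst * e2 - z.snd * e4

/-- The shear `(g, h) ↦ (g + s h, h)`. -/
def G₄.shear {p : ℕ} (s : ZMod p) : RingAut (G₄ p) where
  toFun x := ⟨x.fst + s * x.snd, x.snd⟩
  invFun x := ⟨x.fst - s * x.snd, x.snd⟩
  left_inv x := by ext <;> simp
  right_inv x := by ext <;> simp
  map_mul' x y := by ext <;> simp; ring
  map_add' x y := by ext <;> simp; ring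

/-- Compatibility with `∘` forces an automorphism of `G₄` to be `(g, h) ↦ (d² g + b h, d h)`; if it
is an involution other than `1` then `d = -1`, and a shear removes `b`. -/
theorem G₄.conj_of_sq_eq_one {p : ℕ} (hp : p.Prime) (hp2 : 2 < p) {τ : RingAut (G₄ p)}
    (hτ : τ ^ 2 = 1) :
    ∃ σ ρ : RingAut (G₄ p), (ρ = 1 ∨ ρ = G₄.β p) ∧ τ * σ = σ * ρ := by
  have : Fact p.Prime := ⟨hp⟩
  have h2 := two_ne_zero_zmod hp2
  obtain ⟨a, b, c, d, hm⟩ := G₄.exists_coeff τ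
  have hτ2 : ∀ x y, τ (τ ⟨x, y⟩) = ⟨x, y⟩ := fun x y => by
    rw [← RingAut.mul_apply, ← sq, hτ, RingAut.one_apply]
  -- Preservation of `(0, 1) ∘ (0, 1) = (1, 2)`.
  have hmul := map_mul τ (⟨0, 1⟩ : G₄ p) ⟨0, 1⟩
  simp only [G₄.mul_def, hm, G₄.ext_iff] at hmul
  have ha : a = d * d := by linear_combination hmul.1
  have hc : c = 0 := by linear_combination hmul.2
  have h01 := hτ2 0 1
  simp only [hm, G₄.ext_iff, hc] at h01
  have hd : (d - 1) * (d + 1) = 0 := by linear_combination h01.2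
  rcases mul_eq_zero.1 hd with h | h
  · have hd : d = 1 := sub_eq_zero.1 h
    have hb : b = 0 := by
      have h3 : 2 * b = 0 := by
        have h3 := h01.1
        rw [ha, hd] at h3
        linear_combination h3
      exact (mul_eq_zero.1 h3).resolve_left h2
    refine ⟨1, 1, Or.inl rfl, ?_⟩
    ext x
    · change (τ ⟨x.fst, x.snd⟩).fst = x.fst
      rw [hm, ha, hd, hb]
      ring
    · change (τ ⟨x.fst, x.snd⟩).snd = x.snd
      rw [hm, hc, hd]
      ring
  · have hd : d = -1 := eq_neg_of_add_eq_zero_left h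
    have hs : 2 * (-b / 2) = -b := mul_div_cancel₀ _ h2
    refine ⟨G₄.shear (-b / 2), G₄.β p, Or.inr rfl, ?_⟩
    ext x
    · change (τ ⟨_, _⟩).fst = x.fst + (-b / 2) * (-x.snd)
      rw [hm, ha, hd]
      linear_combination x.snd * hs
    · change (τ ⟨_, _⟩).snd = -x.snd
      rw [hm, hc, hd]
      ring

/-! ### Recognizing semidirect products with `ℤ/2` -/

section

variable {B : Type*} [LeftSemiBrace B]

theorem one_mem_idempotents : (1 : B) ∈ idempotents B := one_add_eq 1

/-- Idempotents are left identities, since the addition is left cancellative. -/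
theorem add_eq_of_mem_idempotents {e : B} (he : e ∈ idempotents B) (x : B) : e + x = x := by
  have he : e + e = e := he
  have h : e + (e + x) = e + x := by rw [← add_assoc, he]
  exact add_left_cancel h

theorem mem_skewPart_iff {x : B} : x ∈ skewPart B ↔ x + 1 = x := mem_range_add_one_iff x

theorem mul_eq_add (a b : B) : a * b = a + a * (a⁻¹ + b) := by
  have h := mul_add_eq a 1 b
  rwa [one_add_eq, mul_one] at h

/-- `λ_a(b) = a ∘ (a⁻ + b)` is additive in `b`. -/
theorem mul_inv_add_add (a b c : B) :
    a * (a⁻¹ + (b + c)) = a * (a⁻¹ + b) + a * (a⁻¹ + c) := by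
  rw [← add_assoc, mul_add_eq]

theorem mul_inv_add_mem_idempotents (a : B) {e : B} (he : e ∈ idempotents B) :
    a * (a⁻¹ + e) ∈ idempotents B := by
  have he : e + e = e := he
  change _ + _ = _
  rw [← mul_inv_add_add, he]

/-- The elements of `G = B + 1` form a left semi-brace whose addition is a group. -/
instance : LeftSemiBrace (skewPart B) where
  add x y := ⟨x + y, ⟨x + y, by
    change (x : B) + y + 1 = x + y
    rw [add_assoc, mem_skewPart_iff.1 y.2]⟩⟩
  add_assoc x y z := Subtype.ext (add_assoc (x : B) y z)
  add_left_cancel x y z h := Subtype.ext (add_left_cancel (congrArg Subtype.val h))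
  mul_add_eq x y z := Subtype.ext (mul_add_eq (x : B) y z)

theorem coe_skewPart_add (x y : skewPart B) : ((x + y : skewPart B) : B) = x + y := rfl

/-- In a finite left cancellative semigroup with a left identity, every element is the sum of one
in `B + 1` and an idempotent. -/
theorem exists_skewPart_add_idempotent [Finite B] (x : B) :
    ∃ g ∈ skewPart B, ∃ e ∈ idempotents B, g + e = x := by
  have hinj : Function.Injective (x + ·) := fun _ _ h => add_left_cancel h
  obtain ⟨e, he⟩ := Finite.surjective_of_injective hinj x
  have he : x + e = x := he
  refine ⟨x + 1, ⟨x, rfl⟩, e, ?_, ?_⟩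
  · have h : x + (e + e) = x + e := by rw [← add_assoc, he, he]
    exact add_left_cancel h
  · rw [add_assoc, one_add_eq, he]

variable {t : B}

theorem mul_self_eq_one_of_idempotents (ht1 : t ≠ 1) (ht : idempotents B = {1, t}) : t * t = 1 := by
  have htE : t ∈ idempotents B := by rw [ht]; exact Or.inr rfl
  have h : t * t ∈ idempotents B := by
    rw [mul_eq_add, add_eq_of_mem_idempotents htE]
    exact mul_inv_add_mem_idempotents t htE
  rw [ht] at h
  exact h.resolve_right fun h => ht1 (mul_eq_left.1 h)

theorem mul_eq_add_of_mem_skewPart (ht1 : t ≠ 1) (ht : idempotents B = {1, t}) {x : B}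
    (hx : x ∈ skewPart B) : x * t = x + t := by
  have htE : t ∈ idempotents B := by rw [ht]; exact Or.inr rfl
  have h := mul_inv_add_mem_idempotents x htE
  rw [ht] at h
  -- `λ_x` permutes `E = {1, t}` and fixes `1`, hence it fixes `t`.
  have h1 := (mul_inv_add_one_eq_iff x).2 (mem_skewPart_iff.1 hx)
  rcases h with h | h
  · exact absurd (add_left_cancel (mul_left_cancel (h.trans h1.symm))) ht1
  · rw [mul_eq_add, h]

theorem conj_mem_skewPart (hidx : (skewPart B).index = 2) (x : skewPart B) :
    t * x * t⁻¹ ∈ skewPart B :=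
  (Subgroup.normal_of_index_eq_two hidx).conj_mem x x.2 t

/-- Conjugation by the nontrivial idempotent, as an automorphism of the left semi-brace `G`. -/
def conjSkewPart (hidx : (skewPart B).index = 2) (ht1 : t ≠ 1) (ht : idempotents B = {1, t}) :
    RingAut (skewPart B) where
  toFun x := ⟨t * x * t⁻¹, conj_mem_skewPart hidx x⟩
  invFun x := ⟨t * x * t⁻¹, conj_mem_skewPart hidx x⟩
  left_inv x := by
    have h := inv_eq_of_mul_eq_one_left (mul_self_eq_one_of_idempotents ht1 ht)
    ext
    simp only [h, mul_assoc, mul_self_eq_one_of_idempotents ht1 ht, mul_one]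
    rw [← mul_assoc, mul_self_eq_one_of_idempotents ht1 ht, one_mul]
  right_inv x := by
    have h := inv_eq_of_mul_eq_one_left (mul_self_eq_one_of_idempotents ht1 ht)
    ext
    simp only [h, mul_assoc, mul_self_eq_one_of_idempotents ht1 ht, mul_one]
    rw [← mul_assoc, mul_self_eq_one_of_idempotents ht1 ht, one_mul]
  map_mul' x y := by
    ext
    simp [mul_assoc]
  map_add' x y := by
    have htE : t ∈ idempotents B := by rw [ht]; exact Or.inr rfl
    -- `λ_t(z) = t ∘ z` is the sum of the conjugate of `z` and of `t`.
    have h1 : ∀ z : B, t * (t⁻¹ + z) = t * z := fun z => by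
      rw [mul_eq_add t z, add_eq_of_mem_idempotents htE]
    have h2 : ∀ z : skewPart B, t * (z : B) = t * z * t⁻¹ + t := fun z => by
      rw [← mul_eq_add_of_mem_skewPart ht1 ht (conj_mem_skewPart hidx z), inv_mul_cancel_right]
    have h3 := mul_inv_add_add t (x : B) y
    rw [h1, h1, h1, ← coe_skewPart_add, h2, h2 x, h2 y] at h3
    have h4 := congrArg (· + (1 : B)) h3
    simp only [add_assoc, add_eq_of_mem_idempotents htE] at h4
    rw [mem_skewPart_iff.1 (conj_mem_skewPart hidx _),
      mem_skewPart_iff.1 (conj_mem_skewPart hidx y)] at h4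
    exact Subtype.ext h4

theorem conjSkewPart_sq (hidx : (skewPart B).index = 2) (ht1 : t ≠ 1)
    (ht : idempotents B = {1, t}) : conjSkewPart hidx ht1 ht ^ 2 = 1 := by
  ext x
  rw [sq, RingAut.mul_apply, RingAut.one_apply]
  exact congrArg Subtype.val ((conjSkewPart hidx ht1 ht).left_inv x)

/-- The nontrivial element of `ℤ/2`. -/
def E₂.gen : E₂ := Multiplicative.ofAdd (1 : ZMod 2)

theorem E₂.eq_one_or_gen (c : E₂) : c = 1 ∨ c = E₂.gen := by
  change ZMod 2 at c
  change c = (0 : ZMod 2) ∨ c = (1 : ZMod 2)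
  revert c
  decide

theorem powHom_gen {H : Type*} [Group H] (a : H) (ha : a ^ 2 = 1) : powHom a ha E₂.gen = a :=
  pow_one a

/-- The recognition criterion: `B` is a semidirect product with `ℤ/2` as soon as `G` is the image
of an embedding of `A` and conjugation by the nontrivial idempotent `t` is the given action.
The isomorphism is `(a, c) ↦ ι a ∘ t ^ c = ι a + t ^ c`. -/
theorem nonempty_equiv_semidirect [Finite B] {A : Type*} [LeftSemiBrace A] {α : E₂ →* RingAut A}
    {ι : A → B} (hinj : Function.Injective ι) (hadd : ∀ a b, ι (a + b) = ι a + ι b)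
    (hmul : ∀ a b, ι (a * b) = ι a * ι b) (hrange : Set.range ι = skewPart B)
    (ht1 : t ≠ 1) (ht : idempotents B = {1, t})
    (hconj : ∀ a, t * ι a = ι (α E₂.gen a) * t) :
    Nonempty (B ≃+* Semidirect α) := by
  have htt := mul_self_eq_one_of_idempotents ht1 ht
  have hι : ∀ a, ι a ∈ skewPart B := fun a => by
    have h : ι a ∈ Set.range ι := ⟨a, rfl⟩
    rwa [hrange] at h
  let ε : E₂ →* B := powHom t ((sq t).trans htt)
  have hεg : ε E₂.gen = t := powHom_gen t _
  have hεE : ∀ c, ε c ∈ idempotents B := by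
    intro c
    rcases E₂.eq_one_or_gen c with rfl | rfl
    · rw [map_one]; exact one_mem_idempotents
    · rw [hεg, ht]; exact Or.inr rfl
  have hεadd : ∀ c, ∀ x ∈ skewPart B, x * ε c = x + ε c := by
    intro c x hx
    rcases E₂.eq_one_or_gen c with rfl | rfl
    · rw [map_one, mul_one, mem_skewPart_iff.1 hx]
    · rw [hεg, mul_eq_add_of_mem_skewPart ht1 ht hx]
  have hεconj : ∀ c a, ε c * ι a = ι (α c a) * ε c := by
    intro c a
    rcases E₂.eq_one_or_gen c with rfl | rfl
    · rw [map_one, map_one, RingAut.one_apply, one_mul, mul_one]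
    · rw [hεg, hconj]
  let Φ : Semidirect α → B := fun x => ι x.left * ε x.right
  have hΦadd : ∀ x, Φ x = ι x.left + ε x.right := fun x => hεadd _ _ (hι _)
  have hbij : Function.Bijective Φ := by
    constructor
    · intro x y h
      rw [hΦadd, hΦadd] at h
      have h1 := congrArg (· + (1 : B)) h
      simp only [add_assoc, add_eq_of_mem_idempotents (hεE _)] at h1
      rw [mem_skewPart_iff.1 (hι _), mem_skewPart_iff.1 (hι _)] at h1
      rw [h1] at h
      have h2 := add_left_cancel h
      refine Semidirect.ext (hinj h1) ?_
      rcases E₂.eq_one_or_gen x.right with hx | hx <;>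
        rcases E₂.eq_one_or_gen y.right with hy | hy <;>
        rw [hx, hy] at h2 ⊢
      · rw [map_one, hεg] at h2
        exact absurd h2.symm ht1
      · rw [map_one, hεg] at h2
        exact absurd h2 ht1
    · intro b
      obtain ⟨g, hg, e, he, rfl⟩ := exists_skewPart_add_idempotent b
      obtain ⟨a, rfl⟩ : g ∈ Set.range ι := by rw [hrange]; exact hg
      rw [ht] at he
      rcases he with rfl | rfl
      · exact ⟨⟨a, 1⟩, by rw [hΦadd, map_one]⟩
      · exact ⟨⟨a, E₂.gen⟩, by rw [hΦadd, hεg]⟩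
  refine ⟨({ Equiv.ofBijective Φ hbij with map_mul' := ?_, map_add' := ?_ } :
    Semidirect α ≃+* B).symm⟩
  · intro x y
    change ι (x.left * α x.right y.left) * ε (x.right * y.right) =
      ι x.left * ε x.right * (ι y.left * ε y.right)
    rw [hmul, map_mul, mul_assoc, mul_assoc, ← mul_assoc (ε x.right), hεconj, mul_assoc]
  · intro x y
    change Φ (x + y) = Φ x + Φ y
    rw [hΦadd, hΦadd, hΦadd, Semidirect.add_left, Semidirect.add_right, hadd, Triv.add_def,
      add_assoc, add_assoc, ← add_assoc (ε x.right), add_eq_of_mem_idempotents (hεE _)]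

end

/-! ### The five models -/

namespace Semidirect

variable {A : Type*} [LeftSemiBrace A] {α : E₂ →* RingAut A}

theorem idempotents_eq (hA : ∀ x : A, x + 1 = x) :
    idempotents (Semidirect α) = {x | x.left = 1} := by
  ext x
  constructor
  · intro h
    have h : x.left + x.left = x.left := congrArg Semidirect.left h
    exact add_left_cancel (h.trans (hA _).symm)
  · intro h
    have h : x.left = 1 := h
    refine Semidirect.ext ?_ rfl
    rw [add_left, h, one_add_eq]

theorem skewPart_eq (hA : ∀ x : A, x + 1 = x) :
    (skewPart (Semidirect α) : Set (Semidirect α)) = {x | x.right = 1} := by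
  ext x
  rw [SetLike.mem_coe, mem_skewPart_iff]
  constructor
  · intro h
    exact (congrArg Semidirect.right h).symm
  · intro h
    exact Semidirect.ext (hA _) (Eq.symm h)

theorem card_E₂ : Nat.card E₂ = 2 := Nat.card_zmod 2

theorem card_idempotents (hA : ∀ x : A, x + 1 = x) :
    Nat.card (idempotents (Semidirect α)) = 2 := by
  rw [idempotents_eq hA]
  refine (Nat.card_congr (β := E₂) ?_).trans card_E₂
  exact
    { toFun x := x.1.right
      invFun c := ⟨⟨1, c⟩, rfl⟩
      left_inv x := Subtype.ext (Semidirect.ext (Eq.symm x.2) rfl)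
      right_inv _ := rfl }

theorem card_eq : Nat.card (Semidirect α) = 2 * Nat.card A := by
  rw [Nat.card_congr (⟨fun x => (x.left, x.right), fun x => ⟨x.1, x.2⟩, fun _ => rfl,
    fun _ => rfl⟩ : Semidirect α ≃ A × E₂), Nat.card_prod, card_E₂, mul_comm]

/-- The subgroup `G` of `A ⋊ ℤ/2` is `A × 1`. -/
def skewPartEquiv (hA : ∀ x : A, x + 1 = x) : skewPart (Semidirect α) ≃* A where
  toFun x := x.1.left
  invFun a := ⟨⟨a, 1⟩, mem_skewPart_iff.2 (Semidirect.ext (hA a) rfl)⟩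
  left_inv x := by
    have h : (x : Semidirect α) ∈ (skewPart (Semidirect α) : Set (Semidirect α)) := x.2
    rw [skewPart_eq hA] at h
    exact Subtype.ext (Semidirect.ext rfl (Eq.symm h))
  right_inv _ := rfl
  map_mul' x y := by
    have h : (x : Semidirect α) ∈ (skewPart (Semidirect α) : Set (Semidirect α)) := x.2
    rw [skewPart_eq hA] at h
    have h : (x : Semidirect α).right = 1 := h
    change x.1.left * α x.1.right y.1.left = _
    rw [h, map_one, RingAut.one_apply]

theorem model_properties {p : ℕ} (hA : ∀ x : A, x + 1 = x)
    (e : A ≃* Multiplicative (ZMod p × ZMod p)) :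
    Nat.card (Semidirect α) = 2 * p ^ 2 ∧
      idempotents (Semidirect α) = {x | x.left = 1} ∧
      (skewPart (Semidirect α) : Set (Semidirect α)) = {x | x.right = 1} ∧
      Nat.card (idempotents (Semidirect α)) = 2 ∧
      Nonempty (skewPart (Semidirect α) ≃* Multiplicative (ZMod p × ZMod p)) := by
  refine ⟨?_, idempotents_eq hA, skewPart_eq hA, card_idempotents hA, ⟨(skewPartEquiv hA).trans e⟩⟩
  rw [card_eq, card_of_mulEquiv e]

end Semidirect

/-! ### Invariants separating the models -/

/-- The two operations agree on `G`. -/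
def IsTrivialOnSkewPart (B : Type*) [LeftSemiBrace B] : Prop :=
  ∀ x y : B, x + 1 = x → y + 1 = y → x + y = x * y

/-- The group `(B, ∘)` is commutative. -/
def HasCommutativeMul (B : Type*) [LeftSemiBrace B] : Prop :=
  ∀ x y : B, x * y = y * x

/-- The subgroup `G` contains a nontrivial central element of `(B, ∘)`. -/
def HasCentralInSkewPart (B : Type*) [LeftSemiBrace B] : Prop :=
  ∃ x : B, x ≠ 1 ∧ x + 1 = x ∧ ∀ y, x * y = y * x

section Invariance

variable {B C : Type*} [LeftSemiBrace B] [LeftSemiBrace C]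

theorem IsTrivialOnSkewPart.of_equiv (f : B ≃+* C) (h : IsTrivialOnSkewPart B) :
    IsTrivialOnSkewPart C := by
  intro x y hx hy
  have h1 : ∀ z : C, z + 1 = z → f.symm z + 1 = f.symm z := fun z hz => by
    rw [← map_one f.symm, ← map_add, hz]
  have h2 := congrArg f (h _ _ (h1 x hx) (h1 y hy))
  simpa using h2

theorem HasCommutativeMul.of_equiv (f : B ≃+* C) (h : HasCommutativeMul B) :
    HasCommutativeMul C := by
  intro x y
  simpa using congrArg f (h (f.symm x) (f.symm y))

theorem HasCentralInSkewPart.of_equiv (f : B ≃+* C) (h : HasCentralInSkewPart B) :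
    HasCentralInSkewPart C := by
  obtain ⟨x, hx, hx1, hc⟩ := h
  refine ⟨f x, fun h => hx (f.injective (h.trans (map_one f).symm)), ?_, fun y => ?_⟩
  · rw [← map_one f, ← map_add, hx1]
  · simpa using congrArg f (hc (f.symm y))

end Invariance

section Invariants

variable {A : Type*} [LeftSemiBrace A] {α : E₂ →* RingAut A}

theorem isTrivialOnSkewPart_semidirect_iff (hA : ∀ x : A, x + 1 = x) :
    IsTrivialOnSkewPart (Semidirect α) ↔ ∀ a b : A, a + b = a * b := by
  constructor
  · intro h a b
    have h1 := congrArg Semidirect.left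
      (h ⟨a, 1⟩ ⟨b, 1⟩ (Semidirect.ext (hA a) rfl) (Semidirect.ext (hA b) rfl))
    rwa [Semidirect.add_left, Semidirect.mul_left, map_one, RingAut.one_apply] at h1
  · intro h x y hx hy
    have hx : x.right = 1 := (congrArg Semidirect.right hx).symm
    refine Semidirect.ext ?_ ?_
    · rw [Semidirect.add_left, Semidirect.mul_left, hx, map_one, RingAut.one_apply, h]
    · rw [Semidirect.add_right, Semidirect.mul_right, hx, one_mul, Triv.add_def]

theorem hasCommutativeMul_semidirect_iff (hA : ∀ a b : A, a * b = b * a) :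
    HasCommutativeMul (Semidirect α) ↔ ∀ a : A, α E₂.gen a = a := by
  constructor
  · intro h a
    have h1 := congrArg Semidirect.left (h ⟨1, E₂.gen⟩ ⟨a, 1⟩)
    simpa using h1
  · intro h x y
    have h1 : ∀ c, ∀ a : A, α c a = a := by
      intro c a
      rcases E₂.eq_one_or_gen c with rfl | rfl
      · rw [map_one, RingAut.one_apply]
      · exact h a
    refine Semidirect.ext ?_ (mul_comm (G := Multiplicative (ZMod 2)) _ _)
    rw [Semidirect.mul_left, Semidirect.mul_left, h1, h1, hA]

theorem hasCentralInSkewPart_semidirect_iff (hA : ∀ a b : A, a * b = b * a)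
    (hA1 : ∀ x : A, x + 1 = x) :
    HasCentralInSkewPart (Semidirect α) ↔ ∃ a : A, a ≠ 1 ∧ α E₂.gen a = a := by
  constructor
  · rintro ⟨x, hx, hx1, hc⟩
    have hr : x.right = 1 := (congrArg Semidirect.right hx1).symm
    refine ⟨x.left, fun h => hx (Semidirect.ext h hr), ?_⟩
    have h1 := congrArg Semidirect.left (hc ⟨1, E₂.gen⟩)
    simpa using h1.symm
  · rintro ⟨a, ha, hfix⟩
    refine ⟨⟨a, 1⟩, fun h => ha (congrArg Semidirect.left h), Semidirect.ext (hA1 a) rfl,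
      fun y => ?_⟩
    have h1 : α y.right a = a := by
      rcases E₂.eq_one_or_gen y.right with h | h
      · rw [h, map_one, RingAut.one_apply]
      · rw [h, hfix]
    refine Semidirect.ext ?_ (mul_comm (G := Multiplicative (ZMod 2)) _ _)
    rw [Semidirect.mul_left, Semidirect.mul_left, h1, map_one, RingAut.one_apply, hA]

end Invariants

theorem G₃.add_one (p : ℕ) (x : G₃ p) : x + 1 = x := by ext <;> simp

theorem G₄.add_one (p : ℕ) (x : G₄ p) : x + 1 = x := by ext <;> simp

theorem G₃.mul_comm_all (p : ℕ) (x y : G₃ p) : x * y = y * x := by ext <;> simp [add_comm]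

theorem G₄.mul_comm_all (p : ℕ) (x y : G₄ p) : x * y = y * x := by ext <;> simp <;> ring

/-- The multiplicative group of `G₃` is `(ℤ/p)²`. -/
def G₃.mulEquiv (p : ℕ) : G₃ p ≃* Multiplicative (ZMod p × ZMod p) where
  toFun x := Multiplicative.ofAdd (x.fst, x.snd)
  invFun x := ⟨x.toAdd.1, x.toAdd.2⟩
  left_inv _ := rfl
  right_inv _ := rfl
  map_mul' _ _ := rfl

/-- The multiplicative group of `G₄` is `(ℤ/p)²` for odd `p`: since
`f₁ f₂ = ((f₁ + f₂)² - f₁² - f₂²) / 2`, the map `(g, f) ↦ (g - f² / 2, f)` linearizes `∘`. -/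
def G₄.mulEquiv {p : ℕ} [Fact p.Prime] (h2 : (2 : ZMod p) ≠ 0) :
    G₄ p ≃* Multiplicative (ZMod p × ZMod p) where
  toFun x := Multiplicative.ofAdd (x.fst - x.snd ^ 2 / 2, x.snd)
  invFun x := ⟨x.toAdd.1 + x.toAdd.2 ^ 2 / 2, x.toAdd.2⟩
  left_inv x := G₄.ext (sub_add_cancel _ _) rfl
  right_inv x := congrArg Multiplicative.ofAdd (Prod.ext (add_sub_cancel_right _ _) rfl)
  map_mul' x y := by
    refine congrArg Multiplicative.ofAdd (Prod.ext ?_ rfl)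
    change x.fst + y.fst + x.snd * y.snd - (x.snd + y.snd) ^ 2 / 2 =
      x.fst - x.snd ^ 2 / 2 + (y.fst - y.snd ^ 2 / 2)
    field_simp
    ring

theorem model_isTrivialOnSkewPart_iff {p : ℕ} [Fact p.Prime] (i : Fin 5) :
    IsTrivialOnSkewPart (Model p i) ↔ i = 0 ∨ i = 1 ∨ i = 2 := by
  have h3 : ∀ a b : G₃ p, a + b = a * b := fun _ _ => rfl
  have h4 : ¬ ∀ a b : G₄ p, a + b = a * b := by
    intro h
    have h1 := congrArg G₄.fst (h ⟨0, 1⟩ ⟨0, 1⟩)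
    simp at h1
  fin_cases i
  · exact iff_of_true ((isTrivialOnSkewPart_semidirect_iff (G₃.add_one p)).2 h3) (by decide)
  · exact iff_of_true ((isTrivialOnSkewPart_semidirect_iff (G₃.add_one p)).2 h3) (by decide)
  · exact iff_of_true ((isTrivialOnSkewPart_semidirect_iff (G₃.add_one p)).2 h3) (by decide)
  · exact iff_of_false (mt (isTrivialOnSkewPart_semidirect_iff (G₄.add_one p)).1 h4) (by decide)
  · exact iff_of_false (mt (isTrivialOnSkewPart_semidirect_iff (G₄.add_one p)).1 h4) (by decide)

theorem neg_one_ne_one_zmod {p : ℕ} (h2 : (2 : ZMod p) ≠ 0) : (-1 : ZMod p) ≠ 1 := by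
  intro h
  apply h2
  linear_combination -h

theorem model_hasCommutativeMul_iff {p : ℕ} (h2 : (2 : ZMod p) ≠ 0) (i : Fin 5) :
    HasCommutativeMul (Model p i) ↔ i = 0 ∨ i = 3 := by
  have h := neg_one_ne_one_zmod h2
  fin_cases i
  · exact iff_of_true ((hasCommutativeMul_semidirect_iff (G₃.mul_comm_all p)).2 fun _ => rfl)
      (by decide)
  · refine iff_of_false (mt (hasCommutativeMul_semidirect_iff (G₃.mul_comm_all p)).1 fun h1 => h ?_)
      (by decide)
    have h1 := h1 ⟨0, 1⟩
    exact congrArg G₃.snd h1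
  · refine iff_of_false (mt (hasCommutativeMul_semidirect_iff (G₃.mul_comm_all p)).1 fun h1 => h ?_)
      (by decide)
    have h1 := h1 ⟨0, 1⟩
    exact congrArg G₃.snd h1
  · exact iff_of_true ((hasCommutativeMul_semidirect_iff (G₄.mul_comm_all p)).2 fun _ => rfl)
      (by decide)
  · refine iff_of_false (mt (hasCommutativeMul_semidirect_iff (G₄.mul_comm_all p)).1 fun h1 => h ?_)
      (by decide)
    have h1 := h1 ⟨0, 1⟩
    exact congrArg G₄.snd h1

theorem model_hasCentralInSkewPart_iff {p : ℕ} [Fact p.Prime] (h2 : (2 : ZMod p) ≠ 0)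
    (i : Fin 5) : HasCentralInSkewPart (Model p i) ↔ i ≠ 1 := by
  have h3 : (⟨1, 0⟩ : G₃ p) ≠ 1 := fun h => one_ne_zero (congrArg G₃.fst h)
  have h4 : (⟨1, 0⟩ : G₄ p) ≠ 1 := fun h => one_ne_zero (congrArg G₄.fst h)
  fin_cases i
  · exact iff_of_true ((hasCentralInSkewPart_semidirect_iff (G₃.mul_comm_all p) (G₃.add_one p)).2
      ⟨_, h3, rfl⟩) (by decide)
  · refine iff_of_false (mt (hasCentralInSkewPart_semidirect_iff (G₃.mul_comm_all p)
      (G₃.add_one p)).1 ?_) (by decide)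
    rintro ⟨a, ha, hfix⟩
    have h0 : ∀ x : ZMod p, -x = x → x = 0 := fun x hx => by
      have h : 2 * x = 0 := by linear_combination -hx
      exact (mul_eq_zero.1 h).resolve_left h2
    exact ha (G₃.ext (h0 _ (congrArg G₃.fst hfix)) (h0 _ (congrArg G₃.snd hfix)))
  · refine iff_of_true ((hasCentralInSkewPart_semidirect_iff (G₃.mul_comm_all p) (G₃.add_one p)).2
      ⟨_, h3, ?_⟩) (by decide)
    exact G₃.ext rfl neg_zero
  · exact iff_of_true ((hasCentralInSkewPart_semidirect_iff (G₄.mul_comm_all p) (G₄.add_one p)).2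
      ⟨_, h4, rfl⟩) (by decide)
  · refine iff_of_true ((hasCentralInSkewPart_semidirect_iff (G₄.mul_comm_all p) (G₄.add_one p)).2
      ⟨_, h4, ?_⟩) (by decide)
    exact G₄.ext rfl neg_zero

theorem eq_of_model_equiv {p : ℕ} [Fact p.Prime] (h2 : (2 : ZMod p) ≠ 0) {i j : Fin 5}
    (f : Model p i ≃+* Model p j) : i = j := by
  have h1 : IsTrivialOnSkewPart (Model p i) ↔ IsTrivialOnSkewPart (Model p j) :=
    ⟨.of_equiv f, .of_equiv f.symm⟩
  have h3 : HasCommutativeMul (Model p i) ↔ HasCommutativeMul (Model p j) :=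
    ⟨.of_equiv f, .of_equiv f.symm⟩
  have h4 : HasCentralInSkewPart (Model p i) ↔ HasCentralInSkewPart (Model p j) :=
    ⟨.of_equiv f, .of_equiv f.symm⟩
  rw [model_isTrivialOnSkewPart_iff, model_isTrivialOnSkewPart_iff] at h1
  rw [model_hasCommutativeMul_iff h2, model_hasCommutativeMul_iff h2] at h3
  rw [model_hasCentralInSkewPart_iff h2, model_hasCentralInSkewPart_iff h2] at h4
  clear f
  revert i j
  decide

/-! ### The classification -/

section Classification

variable {B : Type*} [LeftSemiBrace B]

/-- The additive group structure on `G = B + 1`. Its zero is the neutral element of `∘`, and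
`-a = a ∘ (a⁻ + a⁻)`. -/
abbrev skewPartAddGroup : AddGroup (skewPart B) :=
  let _ : Zero (skewPart B) := ⟨1⟩
  let _ : Neg (skewPart B) := ⟨fun a => a * (a⁻¹ + a⁻¹)⟩
  AddGroup.ofRightAxioms add_assoc (fun a => Subtype.ext (mem_skewPart_iff.1 a.2)) fun a => by
    change a + a * (a⁻¹ + a⁻¹) = 1
    rw [← mul_eq_add, mul_inv_cancel]

theorem skewPart_add_comm {p : ℕ} (hp : p.Prime) (hcard : Nat.card (skewPart B) = p ^ 2)
    (a b : skewPart B) : a + b = b + a := by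
  let _ : AddGroup (skewPart B) := skewPartAddGroup
  have : Fact p.Prime := ⟨hp⟩
  have : Nat.card (Multiplicative (skewPart B)) = p ^ 2 := hcard
  have h := (IsPGroup.isMulCommutative_of_card_eq_prime_sq this).is_comm.comm
    (Multiplicative.ofAdd a) (Multiplicative.ofAdd b)
  exact h

theorem skewPart_equiv_G₃_or_G₄ {p : ℕ} (hp : p.Prime) (hp2 : 2 < p)
    (e : skewPart B ≃* Multiplicative (ZMod p × ZMod p)) :
    Nonempty (skewPart B ≃+* G₃ p) ∨ Nonempty (skewPart B ≃+* G₄ p) := by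
  have hcard := card_of_mulEquiv e
  let _ : AddCommGroup (skewPart B) :=
    { skewPartAddGroup with add_comm := skewPart_add_comm hp hcard }
  let _ : CommGroup (skewPart B) :=
    { (inferInstance : Group (skewPart B)) with
      mul_comm := fun a b => e.injective (by rw [map_mul, map_mul, mul_comm]) }
  refine nonempty_equiv_G₃_or_G₄ ?_ hp hp2 e
  intro a b c
  have h1 : a * (b + c) = a * b + a * (a⁻¹ + c) := mul_add_eq a b c
  have h2 : a * c = a + a * (a⁻¹ + c) := mul_eq_add a c
  rw [h1, h2]
  abel

variable {t : B}

/-- A conjugation `σ` between the action of `t` on `G ≅ A` and a given action `α` on `A` yields an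
isomorphism with `A ⋊ ℤ/2`. -/
theorem nonempty_equiv_semidirect_of_conj [Finite B] (hidx : (skewPart B).index = 2)
    (ht1 : t ≠ 1) (ht : idempotents B = {1, t}) {A : Type*} [LeftSemiBrace A]
    {α : E₂ →* RingAut A} (φ : skewPart B ≃+* A) (σ : RingAut A)
    (h : ∀ a, φ (conjSkewPart hidx ht1 ht (φ.symm (σ a))) = σ (α E₂.gen a)) :
    Nonempty (B ≃+* Semidirect α) := by
  refine nonempty_equiv_semidirect (ι := fun a => (φ.symm (σ a) : B)) ?_ ?_ ?_ ?_ ht1 ht ?_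
  · exact Subtype.val_injective.comp (φ.symm.injective.comp σ.injective)
  · intro a b
    rw [map_add, map_add, coe_skewPart_add]
  · intro a b
    rw [map_mul, map_mul, Subgroup.coe_mul]
  · ext x
    constructor
    · rintro ⟨a, rfl⟩
      exact (φ.symm (σ a)).2
    · intro hx
      exact ⟨σ.symm (φ ⟨x, hx⟩), by simp⟩
  · intro a
    rw [← h, φ.symm_apply_apply]
    exact (inv_mul_cancel_right _ _).symm

theorem exists_model_equiv {p : ℕ} (hp : p.Prime) (hp2 : 2 < p)
    (hB : Nat.card B = 2 * p ^ 2) (hE : Nat.card (idempotents B) = 2)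
    (e : skewPart B ≃* Multiplicative (ZMod p × ZMod p)) :
    ∃ i : Fin 5, Nonempty (B ≃+* Model p i) := by
  have hp0 : 0 < p ^ 2 := pow_pos hp.pos 2
  have : Finite B := Nat.finite_of_card_ne_zero (by rw [hB]; omega)
  have hidx : (skewPart B).index = 2 := by
    have h := (skewPart B).index_mul_card
    rw [hB, card_of_mulEquiv e] at h
    exact Nat.eq_of_mul_eq_mul_right hp0 h
  obtain ⟨t, ht1, ht⟩ : ∃ t : B, t ≠ 1 ∧ idempotents B = {1, t} := by
    obtain ⟨x, y, hxy, h⟩ := Set.ncard_eq_two.1 ((Nat.card_coe_set_eq _).symm.trans hE)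
    have h1 : (1 : B) ∈ idempotents B := one_mem_idempotents
    rw [h] at h1
    rcases h1 with rfl | h1
    · exact ⟨y, hxy.symm, h⟩
    · have h1 : 1 = y := h1
      subst h1
      exact ⟨x, hxy, h.trans (Set.pair_comm _ _)⟩
  have hsq : ∀ {A : Type} [LeftSemiBrace A] (φ : skewPart B ≃+* A),
      ((φ.symm.trans (conjSkewPart hidx ht1 ht)).trans φ : RingAut A) ^ 2 = 1 := by
    intro A _ φ
    ext a
    have h := DFunLike.congr_fun (conjSkewPart_sq hidx ht1 ht) (φ.symm a)
    rw [sq, RingAut.mul_apply, RingAut.one_apply] at h ⊢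
    simp only [RingEquiv.trans_apply, RingEquiv.symm_apply_apply, h, RingEquiv.apply_symm_apply]
  rcases skewPart_equiv_G₃_or_G₄ hp hp2 e with ⟨⟨φ⟩⟩ | ⟨⟨φ⟩⟩
  · obtain ⟨σ, ρ, hρ, h⟩ := G₃.conj_of_sq_eq_one hp hp2 (hsq φ)
    have h := fun a => DFunLike.congr_fun h a
    rcases hρ with rfl | rfl | rfl
    · exact ⟨0, nonempty_equiv_semidirect_of_conj hidx ht1 ht φ σ h⟩
    · refine ⟨1, nonempty_equiv_semidirect_of_conj hidx ht1 ht
        (α := powHom (G₃.α₁ p) (G₃.α₁_sq p)) φ σ ?_⟩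
      rw [powHom_gen]
      exact h
    · refine ⟨2, nonempty_equiv_semidirect_of_conj hidx ht1 ht
        (α := powHom (G₃.α₂ p) (G₃.α₂_sq p)) φ σ ?_⟩
      rw [powHom_gen]
      exact h
  · obtain ⟨σ, ρ, hρ, h⟩ := G₄.conj_of_sq_eq_one hp hp2 (hsq φ)
    have h := fun a => DFunLike.congr_fun h a
    rcases hρ with rfl | rfl
    · exact ⟨3, nonempty_equiv_semidirect_of_conj hidx ht1 ht φ σ h⟩
    · refine ⟨4, nonempty_equiv_semidirect_of_conj hidx ht1 ht
        (α := powHom (G₄.β p) (G₄.β_sq p)) φ σ ?_⟩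
      rw [powHom_gen]
      exact h

end Classification

end LeftSemiBrace

theorem mainTheorem6 (p : ℕ) (hp : p.Prime) (hp2 : 2 < p) :
    (∀ i : Fin 5,
      Nat.card (LeftSemiBrace.Model p i) = 2 * p ^ 2 ∧
      LeftSemiBrace.idempotents (LeftSemiBrace.Model p i) = {x | x.left = 1} ∧
      (LeftSemiBrace.skewPart (LeftSemiBrace.Model p i) : Set (LeftSemiBrace.Model p i)) =
        {x | x.right = 1} ∧
      Nat.card (LeftSemiBrace.idempotents (LeftSemiBrace.Model p i)) = 2 ∧
      Nonempty (LeftSemiBrace.skewPart (LeftSemiBrace.Model p i) ≃*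
        Multiplicative (ZMod p × ZMod p))) ∧
    (∀ i j : Fin 5,
      Nonempty (LeftSemiBrace.Model p i ≃+* LeftSemiBrace.Model p j) → i = j) ∧
    (∀ (B : Type*) [LeftSemiBrace B],
      Nat.card B = 2 * p ^ 2 →
      Nat.card (LeftSemiBrace.idempotents B) = 2 →
      Nonempty (LeftSemiBrace.skewPart B ≃* Multiplicative (ZMod p × ZMod p)) →
      ∃ i : Fin 5, Nonempty (B ≃+* LeftSemiBrace.Model p i)) := by

  have : Fact p.Prime := ⟨hp⟩
  have h2 := LeftSemiBrace.two_ne_zero_zmod hp2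
  refine ⟨fun i => ?_, fun i j ⟨f⟩ => LeftSemiBrace.eq_of_model_equiv h2 f,
    fun B _ hB hE ⟨e⟩ => LeftSemiBrace.exists_model_equiv hp hp2 hB hE e⟩
  have h3 := LeftSemiBrace.G₃.add_one p
  have h4 := LeftSemiBrace.G₄.add_one p
  have e3 := LeftSemiBrace.G₃.mulEquiv p
  have e4 := LeftSemiBrace.G₄.mulEquiv h2
  fin_cases i
  · exact LeftSemiBrace.Semidirect.model_properties h3 e3
  · exact LeftSemiBrace.Semidirect.model_properties h3 e3
  · exact LeftSemiBrace.Semidirect.model_properties h3 e3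
  · exact LeftSemiBrace.Semidirect.model_properties h4 e4
  · exact LeftSemiBrace.Semidirect.model_properties h4 e4
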